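/- Let $G$ be a finite simple undirected graph that is $P_5$-free, i.e. no induced subgraph of $G$ is isomorphic to the path $P_5$ on five vertices. Let $\Delta$, $\omega$ and $\chi$ denote the maximum degree, the maximum size of a clique, and the chromatic number of $G$. If $\Delta \geq 9$, then $$\chi \leq \max\{\Delta - 1, \omega\}.$$ In other words, the Borodin–Kostochka conjecture holds for $P_5$-free graphs. -/

import Mathlib

/-!
Put `k = max (Δ - 1) ω`, so that `k ≥ 8`, `Δ ≤ k + 1` and `ω ≤ k`; the claim is that a `P₅`-free
graph with these bounds is `k`-colourable. A minimal counterexample is vertex-critical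
(`IsP5Critical`). Fix a `k`-colouring of the graph minus a vertex `v`. Every colour occurs around
`v`, so at most one colour occurs more than once. If `x` is the only neighbour of its colour, the
uncoloured vertex can be moved from `v` to `x`. Kempe chains are short: in a `P₅`-free graph two
vertices of one chain are at distance at most three (`KempeReach.short`).

The first half shows that the unique neighbours of `v` are pairwise adjacent (`not_isBadPair`). Two
nonadjacent ones, `x` and `y`, are joined by a Kempe chain, and with `v` it forms induced
five-cycles. Each vertex of these cycles sees all other `k - 2` colours, and by the degree bound the
cycles' vertices together repeat at most five colours. As `k - 2 ≥ 6`, there is a tight colour, seen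
exactly once by each of them. Excluding induced `P₅`s forces the tight neighbour `t` of `v` to be
adjacent to a whole five-cycle. Once the uncoloured vertex is moved to `t`, two colours occur twice
around it, too many for its degree.

Hence `v` lies in a `k`-clique `Q` (`exists_clique`), each vertex of which has at most two neighbours
outside. By Hall's theorem, a colouring of the rest that does not extend to `Q` is very
restricted (`outer_color_eq`, `exists_common_color`): the outer neighbours of `Q` all have one
colour `γ`, and exchanging colours on a Kempe chain cannot destroy this pattern, so every chain
from an outer neighbour reaches the neighbourhoods of all vertices of `Q`. As chains are short, some
vertex `w` then has at least four neighbours of colour `γ`. So `w` misses some other colour, and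
recolouring it breaks a chain (`not_rigid`). The same argument, applied to `k - 1` vertices of `Q`,
excludes a vertex outside `Q` adjacent to all but one of its vertices (`not_adj_erase`), which the
restriction on the colourings of the rest relies on.
-/

/-! ### Counting and systems of distinct representatives -/

section Counting

variable {V κ : Type*} [DecidableEq κ]

/-- A finite set whose elements realise all colours of `J` has at least `#J` elements, plus one
more for each colour of `J` that occurs at least twice. -/
theorem card_add_card_repeated_le {N : Finset V} {c : V → κ} {J B : Finset κ} (hBJ : B ⊆ J)
    (h : ∀ j ∈ J, ∃ u ∈ N, c u = j)
    (hB : ∀ j ∈ B, ∃ u ∈ N, ∃ w ∈ N, u ≠ w ∧ c u = j ∧ c w = j) :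
    J.card + B.card ≤ N.card := by
  classical
  calc J.card + B.card
      = ∑ j ∈ J, (1 + if j ∈ B then 1 else 0) := by
        rw [Finset.sum_add_distrib, Finset.sum_boole, Finset.filter_mem_eq_inter,
          Finset.inter_eq_right.2 hBJ]
        simp
    _ ≤ ∑ j ∈ J, (N.filter fun u => c u = j).card := by
        refine Finset.sum_le_sum fun j hj => ?_
        split_ifs with hb
        · obtain ⟨u, hu, w, hw, huw, h1, h2⟩ := hB j hb
          have : 1 < (N.filter fun u => c u = j).card :=
            Finset.one_lt_card.2 ⟨u, by simp [hu, h1], w, by simp [hw, h2], huw⟩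
          omega
        · obtain ⟨u, hu, h1⟩ := h j hj
          have : 0 < (N.filter fun u => c u = j).card :=
            Finset.card_pos.2 ⟨u, by simp [hu, h1]⟩
          omega
    _ = (J.biUnion fun j => N.filter fun u => c u = j).card := by
        rw [Finset.card_biUnion]
        intro i _ j _ hij
        refine Finset.disjoint_left.2 fun u hu hu' => hij ?_
        simp only [Finset.mem_filter] at hu hu'
        rw [← hu.2, hu'.2]
    _ ≤ N.card := Finset.card_le_card fun u hu => by
        simp only [Finset.mem_biUnion, Finset.mem_filter] at hu
        obtain ⟨_, _, h, _⟩ := hu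
        exact h

/-- Hall's theorem for lists that are at most one colour short. -/
theorem exists_injOn_of_lists {s : Finset V} {t : V → Finset κ} {n : ℕ} (hs : s.card ≤ n + 1)
    (h1 : ∀ x ∈ s, n ≤ (t x).card) (h2 : n + 1 ≤ (s.biUnion t).card) :
    ∃ f : V → κ, Set.InjOn f s ∧ ∀ x ∈ s, f x ∈ t x := by
  classical
  have hall : ∀ r : Finset s, r.card ≤ (r.biUnion fun x => t x).card := by
    intro r
    rcases r.eq_empty_or_nonempty with rfl | ⟨x, hx⟩
    · simp
    · rcases Nat.lt_or_ge n r.card with hr | hr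
      · have hrs : r = Finset.univ := by
          apply Finset.eq_univ_of_card
          have := Finset.card_le_univ r
          simp only [Fintype.card_coe] at this ⊢
          omega
        have : s.biUnion t ⊆ r.biUnion fun x => t x := by
          intro i hi
          simp only [Finset.mem_biUnion] at hi ⊢
          obtain ⟨y, hy, hi⟩ := hi
          exact ⟨⟨y, hy⟩, by simp [hrs], hi⟩
        have h3 := Finset.card_le_card this
        have h4 := Finset.card_le_univ r
        simp only [Fintype.card_coe] at h4
        omega
      · refine hr.trans ((h1 x x.2).trans (Finset.card_le_card ?_))
        exact Finset.subset_biUnion_of_mem (fun x : s => t x) hx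
  obtain ⟨f, hf, hft⟩ := (Finset.all_card_le_biUnion_card_iff_exists_injective _).1 hall
  obtain ⟨i0, -⟩ := Finset.card_pos.1 (show 0 < (s.biUnion t).card by omega)
  refine ⟨fun x => if h : x ∈ s then f ⟨x, h⟩ else i0, ?_, ?_⟩
  · intro x hx y hy hxy
    have hx' : x ∈ s := hx
    have hy' : y ∈ s := hy
    simp only [hx', hy', dif_pos] at hxy
    exact congrArg Subtype.val (hf hxy)
  · intro x hx
    simp only [hx, dif_pos]
    exact hft ⟨x, hx⟩

end Counting

/-! ### Kempe chains in graphs without an induced path on five vertices -/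

namespace SimpleGraph

variable {V κ : Type*} {G : SimpleGraph V}

/-- `G` has no induced path on five vertices, in terms of adjacencies. The five vertices are
distinct automatically. -/
def NoInducedP5 (G : SimpleGraph V) : Prop :=
  ∀ p q r s t, G.Adj p q → G.Adj q r → G.Adj r s → G.Adj s t →
    ¬ G.Adj p r → ¬ G.Adj p s → ¬ G.Adj p t → ¬ G.Adj q s → ¬ G.Adj q t → ¬ G.Adj r t → False

theorem noInducedP5_of_not_isIndContained (h : ¬ (pathGraph 5).IsIndContained G) :
    G.NoInducedP5 := by
  intro p q r s t h1 h2 h3 h4 n1 n2 n3 n4 n5 n6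
  refine h ⟨⟨⟨![p, q, r, s, t], ?_⟩, ?_⟩⟩
  · intro i j hij
    fin_cases i <;> fin_cases j <;> first
      | rfl
      | (exfalso; simp at hij; subst hij; simp_all [G.adj_comm])
  · intro i j
    change G.Adj (![p, q, r, s, t] i) (![p, q, r, s, t] j) ↔ _
    fin_cases i <;> fin_cases j <;> simp_all [pathGraph_adj, G.adj_comm]

/-- The function `c` restricts to a proper colouring of the subgraph induced on `H`; its values
outside `H` are irrelevant. -/
def ProperOn (G : SimpleGraph V) (H : Set V) (c : V → κ) : Prop :=
  ∀ u ∈ H, ∀ w ∈ H, G.Adj u w → c u ≠ c w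

theorem ProperOn.mono {H H' : Set V} {c : V → κ} (h : G.ProperOn H c) (hH : H' ⊆ H) :
    G.ProperOn H' c := fun u hu w hw => h u (hH hu) w (hH hw)

/-- Changing the colour of one vertex to a colour that none of its neighbours has. -/
theorem ProperOn.update [DecidableEq V] {H : Set V} {c : V → κ} (h : G.ProperOn H c) {p : V}
    {j : κ} (hj : ∀ u ∈ H, G.Adj p u → c u ≠ j) : G.ProperOn H (Function.update c p j) := by
  intro u hu w hw huw
  by_cases h1 : u = p <;> by_cases h2 : w = p
  · subst h1 h2; exact (huw.ne rfl).elim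
  · subst h1; simpa [h2] using (hj w hw huw).symm
  · subst h2; simpa [h1] using hj u hu huw.symm
  · simpa [h1, h2] using h u hu w hw huw

/-- `u` lies in the Kempe chain of `z`: the component of `z` in the subgraph of `G` induced on the
vertices of `H` with colours `α` and `β`. -/
def KempeReach (G : SimpleGraph V) (H : Set V) (c : V → κ) (α β : κ) : V → V → Prop :=
  Relation.ReflTransGen fun u w =>
    G.Adj u w ∧ u ∈ H ∧ w ∈ H ∧ (c u = α ∨ c u = β) ∧ (c w = α ∨ c w = β)

open Classical in
/-- Exchange `α` and `β` on the Kempe chain of `z`. -/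
noncomputable def kempeSwap (G : SimpleGraph V) (H : Set V) (c : V → κ) (α β : κ) (z : V) :
    V → κ :=
  fun u => if G.KempeReach H c α β z u then Equiv.swap α β (c u) else c u

section Kempe

variable {H : Set V} {c : V → κ} {α β : κ} {z : V}

theorem KempeReach.color {u : V} (h : G.KempeReach H c α β z u) (hz : c z = α) :
    c u = α ∨ c u = β := by
  rcases Relation.ReflTransGen.cases_tail h with rfl | ⟨w, -, hw⟩
  · exact Or.inl hz
  · exact hw.2.2.2.2

theorem kempeSwap_of_reach {u : V} (h : G.KempeReach H c α β z u) (hu : c u = α) :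
    G.kempeSwap H c α β z u = β := by
  classical simp [kempeSwap, h, hu]

theorem kempeSwap_of_not_reach {u : V} (h : ¬ G.KempeReach H c α β z u) :
    G.kempeSwap H c α β z u = c u := by
  simp [kempeSwap, h]

theorem ProperOn.kempeSwap (hc : G.ProperOn H c) (hz : c z = α) :
    G.ProperOn H (G.kempeSwap H c α β z) := by
  classical
  have key : ∀ u ∈ H, ∀ w ∈ H, G.Adj u w → G.KempeReach H c α β z u →
      ¬ G.KempeReach H c α β z w → Equiv.swap α β (c u) ≠ c w := by
    intro u hu w hw huw h1 h2 h3
    have hcu := h1.color hz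
    refine h2 (h1.tail ⟨huw, hu, hw, hcu, ?_⟩)
    rcases hcu with h | h <;> simp [h] at h3 <;> simp [← h3]
  intro u hu w hw huw
  unfold SimpleGraph.kempeSwap
  split_ifs with h1 h2 h2
  · simpa using hc u hu w hw huw
  · exact key u hu w hw huw h1 h2
  · exact (key w hw u hu huw.symm h2 h1).symm
  · exact hc u hu w hw huw

/-- In a graph without induced `P₅`, a shortest path inside a Kempe chain has length at
most three. -/
theorem KempeReach.short (hP : G.NoInducedP5) (hc : G.ProperOn H c) (hz : c z = α) (hzH : z ∈ H)
    {u : V} (h : G.KempeReach H c α β z u) :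
    u = z ∨ (c u = β ∧ G.Adj z u) ∨ (c u = α ∧ ∃ w ∈ H, c w = β ∧ G.Adj z w ∧ G.Adj w u) ∨
      (c u = β ∧ ∃ a ∈ H, ∃ b ∈ H, c a = β ∧ c b = α ∧ G.Adj z a ∧ G.Adj a b ∧ G.Adj b u) := by
  induction h with
  | refl => exact Or.inl rfl
  | @tail u w _ huw ih =>
    obtain ⟨huw, hu, hw, hcu, hcw⟩ := huw
    have hne := hc u hu w hw huw
    rcases ih with rfl | ⟨h1, h2⟩ | ⟨h1, x, hx, h2, h3, h4⟩ | ⟨h1, a, ha, b, hb, h2, h3, h4, h5, h6⟩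
    · refine Or.inr (Or.inl ⟨?_, huw⟩)
      rcases hcw with h | h
      · rw [hz, h] at hne; exact (hne rfl).elim
      · exact h
    · have hcw' : c w = α := by
        rcases hcw with h | h
        · exact h
        · rw [h1, h] at hne; exact (hne rfl).elim
      exact Or.inr (Or.inr (Or.inl ⟨hcw', u, hu, h1, h2, huw⟩))
    · have hcw' : c w = β := by
        rcases hcw with h | h
        · rw [h1, h] at hne; exact (hne rfl).elim
        · exact h
      exact Or.inr (Or.inr (Or.inr ⟨hcw', x, hx, u, hu, h2, h1, h3, h4, huw⟩))
    · have hcw' : c w = α := by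
        rcases hcw with h | h
        · exact h
        · rw [h1, h] at hne; exact (hne rfl).elim
      by_cases e1 : G.Adj z u
      · exact Or.inr (Or.inr (Or.inl ⟨hcw', u, hu, h1, e1, huw⟩))
      by_cases e2 : G.Adj a w
      · exact Or.inr (Or.inr (Or.inl ⟨hcw', a, ha, h2, h4, e2⟩))
      exfalso
      exact hP z a b u w h4 h5 h6 huw (fun h => hc z hzH b hb h (by rw [hz, h3])) e1
        (fun h => hc z hzH w hw h (by rw [hz, hcw']))
        (fun h => hc a ha u hu h (by rw [h2, h1])) e2
        (fun h => hc b hb w hw h (by rw [h3, hcw']))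

end Kempe

/-! ### Critical graphs and unique neighbours -/

/-- A vertex-critical counterexample: a `P₅`-free graph with maximum degree at most `k + 1` and
clique number at most `k` that is not `k`-colourable, although deleting any vertex makes it so.
Degrees and cliques are measured by finite sets of vertices. -/
structure IsP5Critical (G : SimpleGraph V) (k : ℕ) : Prop where
  eight_le : 8 ≤ k
  noInducedP5 : G.NoInducedP5
  card_nbrs_le : ∀ (v : V) (s : Finset V), (∀ u ∈ s, G.Adj v u) → s.card ≤ k + 1
  card_clique_le : ∀ s : Finset V, (∀ u ∈ s, ∀ w ∈ s, u ≠ w → G.Adj u w) → s.card ≤ k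
  exists_properOn : ∀ v : V, ∃ c : V → Fin k, G.ProperOn {v}ᶜ c
  not_properOn : ∀ c : V → Fin k, ¬ G.ProperOn Set.univ c

/-- The vertex `x` is the only neighbour of `v` with its colour. -/
def IsUniqueNbr (G : SimpleGraph V) (c : V → κ) (v x : V) : Prop :=
  G.Adj v x ∧ ∀ y, G.Adj v y → c y = c x → y = x

/-- If `x` is the unique neighbour of `v` with its colour, then the uncoloured vertex may be moved
from `v` to `x`. -/
theorem IsUniqueNbr.shift [DecidableEq V] {c : V → κ} {v x : V} (hx : G.IsUniqueNbr c v x)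
    (hc : G.ProperOn {v}ᶜ c) : G.ProperOn {x}ᶜ (Function.update c v (c x)) := by
  intro u hu w hw huw
  simp only [Set.mem_compl_iff, Set.mem_singleton_iff] at hu hw
  by_cases h1 : u = v <;> by_cases h2 : w = v
  · subst h1 h2; exact (huw.ne rfl).elim
  · subst h1
    simpa [h2] using fun h => hw (hx.2 w huw h.symm)
  · subst h2
    simpa [h1] using fun h => hu (hx.2 u huw.symm h)
  · simpa [h1, h2] using hc u h1 w h2 huw

open Classical in
/-- The neighbours of `x` outside the finite set `R`. -/
noncomputable def outNbrs [Fintype V] (G : SimpleGraph V) (R : Finset V) (x : V) : Finset V :=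
  Finset.univ.filter fun u => u ∉ R ∧ G.Adj x u

theorem mem_outNbrs [Fintype V] {R : Finset V} {x u : V} :
    u ∈ outNbrs G R x ↔ u ∉ R ∧ G.Adj x u := by
  simp [outNbrs]

namespace IsP5Critical

variable {k : ℕ} {c : V → Fin k} {v : V}

/-- All colours occur around the uncoloured vertex. -/
theorem exists_nbr (hG : G.IsP5Critical k) (hc : G.ProperOn {v}ᶜ c) (i : Fin k) :
    ∃ u, G.Adj v u ∧ c u = i := by
  classical
  by_contra! h
  refine hG.not_properOn (Function.update c v i) ?_
  intro u _ w _ huw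
  by_cases h1 : u = v <;> by_cases h2 : w = v
  · subst h1 h2; exact (huw.ne rfl).elim
  · subst h1; simpa [h2] using (h w huw).symm
  · subst h2; simpa [h1] using h u huw.symm
  · simpa [h1, h2] using hc u h1 w h2 huw

/-- Two nonadjacent unique neighbours of the uncoloured vertex are the ends of an alternating
path on four vertices. -/
theorem exists_path (hG : G.IsP5Critical k) (hc : G.ProperOn {v}ᶜ c) {x y : V}
    (hx : G.IsUniqueNbr c v x) (hy : G.IsUniqueNbr c v y) (hxy : x ≠ y) (hadj : ¬ G.Adj x y) :
    ∃ a b, a ≠ v ∧ b ≠ v ∧ c a = c y ∧ c b = c x ∧ G.Adj x a ∧ G.Adj a b ∧ G.Adj b y := by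
  classical
  have hcol : c x ≠ c y := fun h => hxy (hy.2 x hx.1 h)
  have hxv : x ∈ ({v}ᶜ : Set V) := hx.1.ne'
  by_cases hr : G.KempeReach {v}ᶜ c (c x) (c y) x y
  · rcases hr.short hG.noInducedP5 hc rfl hxv with h | h | h | h
    · exact (hxy h.symm).elim
    · exact (hadj h.2).elim
    · exact (hcol h.1.symm).elim
    · obtain ⟨-, a, ha, b, hb, h1, h2, h3, h4, h5⟩ := h
      exact ⟨a, b, ha, hb, h1, h2, h3, h4, h5⟩
  · -- Otherwise exchanging the two colours on the chain of `x` frees the colour of `x` at `v`.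
    exfalso
    obtain ⟨u, hu, hcu⟩ := hG.exists_nbr (hc.kempeSwap (α := c x) (β := c y) (z := x) rfl) (c x)
    by_cases hru : G.KempeReach {v}ᶜ c (c x) (c y) x u
    · rcases hru.color rfl with h | h
      · rw [kempeSwap_of_reach hru h] at hcu
        exact hcol hcu.symm
      · exact hr (hy.2 u hu h ▸ hru)
    · rw [kempeSwap_of_not_reach hru] at hcu
      exact hru (hx.2 u hu hcu ▸ Relation.ReflTransGen.refl)

theorem exists_properOn_compl (hG : G.IsP5Critical k) {R : Finset V} (hv : v ∈ R) :
    ∃ c : V → Fin k, G.ProperOn (↑R)ᶜ c := by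
  obtain ⟨c, hc⟩ := hG.exists_properOn v
  exact ⟨c, hc.mono fun u hu huv => hu (huv ▸ hv)⟩

theorem exists_not_adj [DecidableEq V] (hG : G.IsP5Critical k) {Q : Finset V} (hQk : Q.card = k)
    (hQ : ∀ u ∈ Q, ∀ w ∈ Q, u ≠ w → G.Adj u w) {z : V} (hz : z ∉ Q) : ∃ x ∈ Q, ¬ G.Adj z x := by
  by_contra! h
  have := hG.card_clique_le (insert z Q) (by
    intro u hu w hw huw
    rcases Finset.mem_insert.1 hu with rfl | hu' <;> rcases Finset.mem_insert.1 hw with rfl | hw'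
    · exact (huw rfl).elim
    · exact h w hw'
    · exact (h u hu').symm
    · exact hQ u hu' w hw' huw)
  rw [Finset.card_insert_of_notMem hz] at this
  omega

end IsP5Critical

/-! ### The unique neighbours form a clique -/

/-- Two nonadjacent neighbours `x`, `y` of the uncoloured vertex `v`, each the only one with its
colour. -/
structure IsBadPair (G : SimpleGraph V) (c : V → κ) (v x y : V) : Prop where
  properOn : G.ProperOn {v}ᶜ c
  left : G.IsUniqueNbr c v x
  right : G.IsUniqueNbr c v y
  ne : x ≠ y
  not_adj : ¬ G.Adj x y

/-- The neighbours of `x` that have the colour of `y`, apart from the uncoloured vertex `v`. -/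
def altNbrs (G : SimpleGraph V) (c : V → κ) (v x y : V) : Set V :=
  {a | a ≠ v ∧ G.Adj x a ∧ c a = c y}

/-- For a pair as in `IsBadPair`, the uncoloured vertex `v` together with the Kempe chain of `x`
and `y`. In a `P₅`-free graph this is a union of induced five-cycles through `v`, `x` and `y`. -/
def block (G : SimpleGraph V) (c : V → κ) (v x y : V) : Set V :=
  {v, x, y} ∪ (G.altNbrs c v x y ∪ G.altNbrs c v y x)

theorem block_comm (G : SimpleGraph V) (c : V → κ) (v x y : V) :
    G.block c v x y = G.block c v y x := by
  unfold block
  rw [Set.pair_comm x y, Set.union_comm (G.altNbrs c v x y)]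

/-- Every vertex of the block of `v`, `x`, `y` has exactly one neighbour of colour `j`. -/
def TightOn (G : SimpleGraph V) (c : V → κ) (v x y : V) (j : κ) : Prop :=
  ∀ p ∈ G.block c v x y, ∃! u, u ≠ v ∧ G.Adj p u ∧ c u = j

namespace IsBadPair

variable {c : V → κ} {v x y : V}

theorem symm (h : G.IsBadPair c v x y) : G.IsBadPair c v y x :=
  ⟨h.properOn, h.right, h.left, h.ne.symm, fun h' => h.not_adj h'.symm⟩

theorem color_ne (h : G.IsBadPair c v x y) : c x ≠ c y :=
  fun h' => h.ne (h.right.2 x h.left.1 h')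

theorem not_adj_of_color_eq (h : G.IsBadPair c v x y) {u w : V} (hu : u ≠ v) (hw : w ≠ v)
    (huw : c u = c w) : ¬ G.Adj u w :=
  fun h' => h.properOn u hu w hw h' huw

theorem not_adj_altNbr (h : G.IsBadPair c v x y) {a : V} (ha : a ∈ G.altNbrs c v x y) :
    ¬ G.Adj v a :=
  fun h' => h.not_adj (h.right.2 a h' ha.2.2 ▸ ha.2.1)

theorem adj_altNbrs (hP : G.NoInducedP5) (h : G.IsBadPair c v x y) {a b : V}
    (ha : a ∈ G.altNbrs c v x y) (hb : b ∈ G.altNbrs c v y x) : G.Adj a b := by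
  by_contra hab
  have hx := h.left.1
  have hy := h.right.1
  exact hP a x v y b ha.2.1.symm hx.symm hy hb.2.1 (fun h' => h.not_adj_altNbr ha h'.symm)
    (h.not_adj_of_color_eq ha.1 hy.ne' ha.2.2) hab h.not_adj
    (h.not_adj_of_color_eq hx.ne' hb.1 hb.2.2.symm) (h.symm.not_adj_altNbr hb)

variable {k : ℕ} {c : V → Fin k}

/-- The colour `j` neighbour `t` of `v` is adjacent to `x`: otherwise a Kempe chain from `x` to `t`
in the colours of `x` and `t` produces an induced `P₅`. -/
theorem adj_left_of_tightOn (hG : G.IsP5Critical k) (h : G.IsBadPair c v x y) {j : Fin k}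
    (hjx : j ≠ c x) (hj : G.TightOn c v x y j) {t : V} (hvt : G.Adj v t) (hct : c t = j) :
    G.Adj t x := by
  by_contra htx
  have hP := hG.noInducedP5
  have hx := h.left.1
  have hy := h.right.1
  have uniq : ∀ p ∈ G.block c v x y, ∀ u w, u ≠ v → G.Adj p u → c u = j → w ≠ v → G.Adj p w →
      c w = j → u = w := fun p hp u w h1 h2 h3 h4 h5 h6 => (hj p hp).unique ⟨h1, h2, h3⟩ ⟨h4, h5, h6⟩
  have hv_mem : v ∈ G.block c v x y := by simp [block]
  have hy_mem : y ∈ G.block c v x y := by simp [block]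
  have hA_mem : ∀ a ∈ G.altNbrs c v x y, a ∈ G.block c v x y := fun a ha => Or.inr (Or.inl ha)
  have hB_mem : ∀ b ∈ G.altNbrs c v y x, b ∈ G.block c v x y := fun b hb => Or.inr (Or.inr hb)
  have htu : G.IsUniqueNbr c v t :=
    ⟨hvt, fun u hu hcu => uniq v hv_mem u t hu.ne' hu (hcu.trans hct) hvt.ne' hvt hct⟩
  have hxt : x ≠ t := fun h' => hjx (by rw [h', hct])
  obtain ⟨a, b, hav, hbv, hca, hcb, hxa, hab, hby⟩ :=
    hG.exists_path h.properOn h.left h.right h.ne h.not_adj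
  have ha : a ∈ G.altNbrs c v x y := ⟨hav, hxa, hca⟩
  have hb : b ∈ G.altNbrs c v y x := ⟨hbv, hby.symm, hcb⟩
  obtain ⟨u, w, huv, hwv, hcu, hcw, hxu, huw, hwt⟩ :=
    hG.exists_path h.properOn h.left htu hxt (fun h' => htx h'.symm)
  rw [hct] at hcu
  have hxb : ¬ G.Adj x b := h.not_adj_of_color_eq hx.ne' hbv hcb.symm
  have hva : ¬ G.Adj v a := h.not_adj_altNbr ha
  have hvb : ¬ G.Adj v b := h.symm.not_adj_altNbr hb
  have hay : ¬ G.Adj a y := h.not_adj_of_color_eq hav hy.ne' hca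
  have hwx : ¬ G.Adj w x := h.not_adj_of_color_eq hwv hx.ne' hcw
  have hwv' : ¬ G.Adj w v := fun h' => htx ((h.left.2 w h'.symm hcw) ▸ hwt.symm)
  have hne : u ≠ t := fun h' => htx (h' ▸ hxu.symm)
  -- `w` is not in the component: otherwise it would see the colour `j` twice.
  have hwy : ¬ G.Adj w y := fun h' => hne <|
    uniq w (hB_mem w ⟨hwv, h'.symm, hcw⟩) u t huv huw.symm hcu hvt.ne' hwt hct
  have hwb : ¬ G.Adj w b := h.not_adj_of_color_eq hwv hbv (hcw.trans hcb.symm)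
  have hwa : ¬ G.Adj w a := fun h' =>
    hP w a x v y h' hxa.symm hx.symm hy hwx hwv' hwy (fun h' => hva h'.symm) hay h.not_adj
  have huv' : ¬ G.Adj u v := fun h' => hne
    (uniq v hv_mem u t huv h'.symm hcu hvt.ne' hvt hct)
  have huy : G.Adj u y := by
    by_contra h'
    exact hP w u x v y huw.symm hxu.symm hx.symm hy hwx hwv' hwy huv' h' h.not_adj
  have hty : ¬ G.Adj t y := fun h' => hne
    (uniq y hy_mem u t huv huy.symm hcu hvt.ne' h'.symm hct)
  have hta : G.Adj t a := by
    by_contra h'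
    exact hP w t v x a hwt hvt.symm hx hxa hwv' hwx hwa htx h' hva
  have htb : G.Adj t b := by
    by_contra h'
    exact hP w t v y b hwt hvt.symm hy hby.symm hwv' hwy hwb hty h' hvb
  have hua : ¬ G.Adj u a := fun h' => hne
    (uniq a (hA_mem a ha) u t huv h'.symm hcu hvt.ne' hta.symm hct)
  have hub : ¬ G.Adj u b := fun h' => hne
    (uniq b (hB_mem b hb) u t huv h'.symm hcu hvt.ne' htb.symm hct)
  exact hP w u x a b huw.symm hxu.symm hxa hab hwx hwa hwb hua hub hxb

/-- The colour `j` neighbour of `v`, being adjacent to `x` and `y`, is adjacent to all neighbours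
of `x` that have the colour of `y`. -/
theorem adj_altNbr_of_tightOn (hP : G.NoInducedP5) (h : G.IsBadPair c v x y) {j : Fin k}
    (hj : G.TightOn c v x y j) {t : V} (hvt : G.Adj v t) (hct : c t = j)
    (htx : G.Adj t x) (hty : G.Adj t y) {a : V} (ha : a ∈ G.altNbrs c v x y) : G.Adj t a := by
  obtain ⟨s, ⟨hsv, has, hcs⟩, -⟩ := hj a (Or.inr (Or.inl ha))
  by_cases hst : s = t
  · exact hst ▸ has.symm
  exfalso
  have hx := h.left.1
  have hy := h.right.1
  refine hP s a x v y has.symm ha.2.1.symm hx.symm hy ?_ ?_ ?_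
    (fun h' => h.not_adj_altNbr ha h'.symm) (h.not_adj_of_color_eq ha.1 hy.ne' ha.2.2) h.not_adj
  · exact fun h' => hst ((hj x (by simp [block])).unique ⟨hsv, h'.symm, hcs⟩
      ⟨hvt.ne', htx.symm, hct⟩)
  · exact fun h' => hst ((hj v (by simp [block])).unique ⟨hsv, h'.symm, hcs⟩
      ⟨hvt.ne', hvt, hct⟩)
  · exact fun h' => hst ((hj y (by simp [block])).unique ⟨hsv, h'.symm, hcs⟩
      ⟨hvt.ne', hty.symm, hct⟩)

/-- No further colour can be tight: its vertex at `v` would be complete to a five-cycle, and once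
uncoloured it would see two colours twice. -/
theorem not_tightOn [Fintype V] (hG : G.IsP5Critical k) (h : G.IsBadPair c v x y) {j : Fin k}
    (hjx : j ≠ c x) (hjy : j ≠ c y) : ¬ G.TightOn c v x y j := by
  classical
  intro hj
  have hj' : G.TightOn c v y x j := by
    unfold TightOn; rw [block_comm]; exact hj
  have hP := hG.noInducedP5
  obtain ⟨t, ⟨htv, hvt, hct⟩, htu⟩ := hj v (by simp [block])
  have htx := h.adj_left_of_tightOn hG hjx hj hvt hct
  have hty := h.symm.adj_left_of_tightOn hG hjy hj' hvt hct
  obtain ⟨a, b, hav, hbv, hca, hcb, hxa, hab, hby⟩ :=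
    hG.exists_path h.properOn h.left h.right h.ne h.not_adj
  have hta := h.adj_altNbr_of_tightOn hP hj hvt hct htx hty ⟨hav, hxa, hca⟩
  have htb := h.symm.adj_altNbr_of_tightOn hP hj' hvt hct hty htx ⟨hbv, hby.symm, hcb⟩
  have hc' : G.ProperOn {t}ᶜ (Function.update c v (c t)) :=
    IsUniqueNbr.shift ⟨hvt, fun u hu hcu => htu u ⟨hu.ne', hu, hcu.trans hct⟩⟩ h.properOn
  have hxy := h.color_ne
  have h1 := card_add_card_repeated_le (N := Finset.univ.filter fun u => G.Adj t u)
    (c := Function.update c v (c t)) (B := {c x, c y}) (Finset.subset_univ _) (fun i _ => by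
      obtain ⟨u, hu, hcu⟩ := hG.exists_nbr hc' i
      exact ⟨u, by simpa using hu, hcu⟩) (by
      intro i hi
      simp only [Finset.mem_insert, Finset.mem_singleton] at hi
      have hxv := h.left.1.ne'
      have hyv := h.right.1.ne'
      simp only [Finset.mem_filter, Finset.mem_univ, true_and]
      rcases hi with rfl | rfl
      · exact ⟨x, htx, b, htb, fun h' => h.not_adj (h' ▸ hby), by simp [hxv], by simp [hbv, hcb]⟩
      · exact ⟨y, hty, a, hta, fun h' => h.not_adj (h' ▸ hxa), by simp [hyv],
          by simp [hav, hca]⟩)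
  have h2 := hG.card_nbrs_le t (Finset.univ.filter fun u => G.Adj t u) (by simp)
  rw [Finset.card_pair hxy] at h1
  simp only [Finset.card_univ, Fintype.card_fin] at h1
  omega

/-- If the colours other than those of `x` and `y` occur around every vertex of the block, then one
of these colours is tight. The degree bound leaves room for at most `3 - #P` repeated colours at a
vertex with a set `P` of neighbours inside the block, which adds up to at most five, fewer than
the `k - 2` colours available. -/
theorem exists_tightOn [Fintype V] (hG : G.IsP5Critical k) (h : G.IsBadPair c v x y)
    (hsee : ∀ p ∈ G.block c v x y, ∀ j, j ≠ c x → j ≠ c y → ∃ u, u ≠ v ∧ G.Adj p u ∧ c u = j) :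
    ∃ j, j ≠ c x ∧ j ≠ c y ∧ G.TightOn c v x y j := by
  classical
  set J : Finset (Fin k) := Finset.univ \ {c x, c y} with hJ
  have hJmem : ∀ j, j ∈ J ↔ j ≠ c x ∧ j ≠ c y := by intro j; simp [hJ]
  have hJcard : J.card + 2 = k := by
    rw [← Finset.card_pair h.color_ne, hJ, Finset.card_sdiff_add_card_eq_card
      (Finset.subset_univ _), Finset.card_univ, Fintype.card_fin]
  have hk := hG.eight_le
  let bad : V → Finset (Fin k) := fun p => J.filter fun j =>
    ∃ u w, u ≠ w ∧ (u ≠ v ∧ G.Adj p u ∧ c u = j) ∧ (w ≠ v ∧ G.Adj p w ∧ c w = j)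
  have hbad : ∀ p ∈ G.block c v x y, ∀ P : Finset V,
      (∀ q ∈ P, G.Adj p q ∧ (q = v ∨ c q = c x ∨ c q = c y)) → (bad p).card + P.card ≤ 3 := by
    intro p hp P hP
    let N : Finset V := Finset.univ.filter fun u => u ≠ v ∧ G.Adj p u ∧ c u ∈ J
    have h1 : J.card + (bad p).card ≤ N.card := by
      refine card_add_card_repeated_le (c := c) (Finset.filter_subset _ _) ?_ ?_
      · intro j hj
        obtain ⟨u, hu1, hu2, rfl⟩ := hsee p hp j ((hJmem j).1 hj).1 ((hJmem j).1 hj).2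
        exact ⟨u, by simp [N, hu1, hu2, hj], rfl⟩
      · intro j hj
        obtain ⟨hj, u, w, huw, ⟨hu1, hu2, hu3⟩, hw1, hw2, hw3⟩ := Finset.mem_filter.1 hj
        exact ⟨u, by simp [N, hu1, hu2, hu3, hj], w, by simp [N, hw1, hw2, hw3, hj], huw, hu3, hw3⟩
    have h2 : Disjoint N P := by
      refine Finset.disjoint_left.2 fun u hu hu' => ?_
      simp only [N, Finset.mem_filter, hJmem] at hu
      rcases (hP u hu').2 with h' | h' | h'
      · exact hu.2.1 h'
      · exact hu.2.2.2.1 h'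
      · exact hu.2.2.2.2 h'
    have h3 := hG.card_nbrs_le p (N ∪ P) (by
      intro u hu
      rcases Finset.mem_union.1 hu with hu | hu
      · exact (Finset.mem_filter.1 hu).2.2.1
      · exact (hP u hu).1)
    rw [Finset.card_union_of_disjoint h2] at h3
    omega
  let A : Finset V := Finset.univ.filter fun a => a ∈ G.altNbrs c v x y
  let B : Finset V := Finset.univ.filter fun b => b ∈ G.altNbrs c v y x
  have hA : ∀ a, a ∈ A ↔ a ∈ G.altNbrs c v x y := by intro a; simp [A]
  have hB : ∀ b, b ∈ B ↔ b ∈ G.altNbrs c v y x := by intro b; simp [B]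
  obtain ⟨a, b, hav, hbv, hca, hcb, hxa, hab, hby⟩ :=
    hG.exists_path h.properOn h.left h.right h.ne h.not_adj
  have hA1 : 0 < A.card := Finset.card_pos.2 ⟨a, (hA a).2 ⟨hav, hxa, hca⟩⟩
  have hB1 : 0 < B.card := Finset.card_pos.2 ⟨b, (hB b).2 ⟨hbv, hby.symm, hcb⟩⟩
  have bv : (bad v).card + ({x, y} : Finset V).card ≤ 3 := hbad v (by simp [block]) _ (by
    simp [h.left.1, h.right.1])
  rw [Finset.card_pair h.ne] at bv
  have bx : (bad x).card + (insert v A).card ≤ 3 := hbad x (by simp [block]) _ (by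
    intro q hq
    rcases Finset.mem_insert.1 hq with rfl | hq
    · exact ⟨h.left.1.symm, Or.inl rfl⟩
    · exact ⟨((hA q).1 hq).2.1, Or.inr (Or.inr ((hA q).1 hq).2.2)⟩)
  rw [Finset.card_insert_of_notMem fun hv => ((hA v).1 hv).1 rfl] at bx
  have byy : (bad y).card + (insert v B).card ≤ 3 := hbad y (by simp [block]) _ (by
    intro q hq
    rcases Finset.mem_insert.1 hq with rfl | hq
    · exact ⟨h.right.1.symm, Or.inl rfl⟩
    · exact ⟨((hB q).1 hq).2.1, Or.inr (Or.inl ((hB q).1 hq).2.2)⟩)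
  rw [Finset.card_insert_of_notMem fun hv => ((hB v).1 hv).1 rfl] at byy
  have ba : ∀ a ∈ A, (bad a).card ≤ 2 - B.card := by
    intro a ha
    have ha' := (hA a).1 ha
    have := hbad a (Or.inr (Or.inl ha')) (insert x B) (by
      intro q hq
      rcases Finset.mem_insert.1 hq with rfl | hq
      · exact ⟨ha'.2.1.symm, Or.inr (Or.inl rfl)⟩
      · exact ⟨h.adj_altNbrs hG.noInducedP5 ha' ((hB q).1 hq),
          Or.inr (Or.inl ((hB q).1 hq).2.2)⟩)
    rw [Finset.card_insert_of_notMem fun hx => h.not_adj ((hB x).1 hx).2.1.symm] at this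
    omega
  have bb : ∀ b ∈ B, (bad b).card ≤ 2 - A.card := by
    intro b hb
    have hb' := (hB b).1 hb
    have := hbad b (Or.inr (Or.inr hb')) (insert y A) (by
      intro q hq
      rcases Finset.mem_insert.1 hq with rfl | hq
      · exact ⟨hb'.2.1.symm, Or.inr (Or.inr rfl)⟩
      · exact ⟨(h.adj_altNbrs hG.noInducedP5 ((hA q).1 hq) hb').symm,
          Or.inr (Or.inr ((hA q).1 hq).2.2)⟩)
    rw [Finset.card_insert_of_notMem fun hy => h.not_adj ((hA y).1 hy).2.1] at this
    omega
  have ba' := Finset.card_biUnion_le_card_mul A bad _ ba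
  have bb' := Finset.card_biUnion_le_card_mul B bad _ bb
  have u1 := Finset.card_union_le (bad v) (bad x)
  have u2 := Finset.card_union_le (bad v ∪ bad x) (bad y)
  have u3 := Finset.card_union_le (bad v ∪ bad x ∪ bad y) (A.biUnion bad)
  have u4 := Finset.card_union_le (bad v ∪ bad x ∪ bad y ∪ A.biUnion bad) (B.biUnion bad)
  have hlt : (bad v ∪ bad x ∪ bad y ∪ A.biUnion bad ∪ B.biUnion bad).card < J.card := by
    have hA2 : A.card ≤ 2 := by omega
    have hB2 : B.card ≤ 2 := by omega
    generalize A.card = m at *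
    generalize B.card = n at *
    interval_cases m <;> interval_cases n <;> omega
  obtain ⟨j, hj, hjn⟩ := Finset.exists_mem_notMem_of_card_lt_card hlt
  simp only [Finset.mem_union, Finset.mem_biUnion, not_or, not_exists, not_and] at hjn
  obtain ⟨⟨⟨⟨nv, nx⟩, ny⟩, na⟩, nb⟩ := hjn
  obtain ⟨hjx, hjy⟩ := (hJmem j).1 hj
  refine ⟨j, hjx, hjy, fun p hp => ?_⟩
  have hpj : j ∉ bad p := by
    rcases hp with (rfl | rfl | rfl) | hp | hp
    · exact nv
    · exact nx
    · exact ny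
    · exact na p ((hA p).2 hp)
    · exact nb p ((hB p).2 hp)
  obtain ⟨u, hu⟩ := hsee p hp j hjx hjy
  refine ⟨u, hu, fun w hw => ?_⟩
  by_contra hwu
  exact hpj (Finset.mem_filter.2 ⟨hj, w, u, hwu, hw, hu⟩)

/-- Otherwise `x` could be recoloured with `j` and its old colour given to `v`. -/
theorem exists_nbr_left (hG : G.IsP5Critical k) (h : G.IsBadPair c v x y) {j : Fin k}
    (hj : j ≠ c x) : ∃ u, u ≠ v ∧ G.Adj x u ∧ c u = j := by
  classical
  by_contra! hn
  obtain ⟨u, hu, hcu⟩ := hG.exists_nbr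
    (h.properOn.update (p := x) (j := j) fun u hu hxu => hn u hu hxu) (c x)
  by_cases hux : u = x
  · subst hux; exact hj (by simpa using hcu)
  · exact hux (h.left.2 u hu (by simpa [hux] using hcu))

/-- Recolouring a neighbour of `x` with the colour of `y` by a third colour makes the block
smaller. -/
theorem recolor [DecidableEq V] (h : G.IsBadPair c v x y) {j : Fin k} (hjx : j ≠ c x)
    (hjy : j ≠ c y) {a : V} (ha : a ∈ G.altNbrs c v x y)
    (hn : ∀ u, u ≠ v → G.Adj a u → c u ≠ j) :
    G.IsBadPair (Function.update c a j) v x y ∧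
      G.altNbrs (Function.update c a j) v x y = G.altNbrs c v x y \ {a} ∧
      G.altNbrs (Function.update c a j) v y x = G.altNbrs c v y x := by
  have hva := h.not_adj_altNbr ha
  have hxa : x ≠ a := fun h' => hva (h' ▸ h.left.1)
  have hya : y ≠ a := fun h' => hva (h' ▸ h.right.1)
  have key : ∀ u, G.Adj v u → Function.update c a j u = c u := fun u hu => by
    have : u ≠ a := fun h' => hva (h' ▸ hu)
    simp [this]
  refine ⟨⟨h.properOn.update fun u hu => hn u hu, ⟨h.left.1, fun u hu hcu => ?_⟩,
    ⟨h.right.1, fun u hu hcu => ?_⟩, h.ne, h.not_adj⟩, ?_, ?_⟩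
  · rw [key u hu, key x h.left.1] at hcu; exact h.left.2 u hu hcu
  · rw [key u hu, key y h.right.1] at hcu; exact h.right.2 u hu hcu
  · ext u
    by_cases hu : u = a
    · subst hu; simp [altNbrs, hya, hjy]
    · simp [altNbrs, hya, hu]
  · ext u
    by_cases hu : u = a
    · subst hu
      simp only [altNbrs, Set.mem_ofPred_eq, Function.update_self, ne_eq, hxa, not_false_eq_true,
        Function.update_of_ne, hjx, and_false, false_iff, not_and]
      exact fun _ _ h' => h.color_ne (h'.symm.trans ha.2.2)
    · simp [altNbrs, hxa, hu]

end IsBadPair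

/-- In a critical graph the unique neighbours of an uncoloured vertex are pairwise adjacent. -/
theorem IsP5Critical.not_isBadPair [Fintype V] {k : ℕ} (hG : G.IsP5Critical k) {c : V → Fin k}
    {v x y : V} : ¬ G.IsBadPair c v x y := by
  classical
  suffices H : ∀ (n : ℕ) (c : V → Fin k),
      (G.altNbrs c v x y).ncard + (G.altNbrs c v y x).ncard < n → ¬ G.IsBadPair c v x y from
    H _ c (Nat.lt_succ_self _)
  intro n
  induction n with
  | zero => intro c hc; omega
  | succ n ih =>
    intro c hn h
    by_cases hsee : ∀ p ∈ G.block c v x y, ∀ j, j ≠ c x → j ≠ c y →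
        ∃ u, u ≠ v ∧ G.Adj p u ∧ c u = j
    · obtain ⟨j, hjx, hjy, hj⟩ := h.exists_tightOn hG hsee
      exact h.not_tightOn hG hjx hjy hj
    push Not at hsee
    obtain ⟨p, hp, j, hjx, hjy, hpj⟩ := hsee
    rcases hp with (rfl | rfl | rfl) | hp | hp
    · obtain ⟨u, hu, hcu⟩ := hG.exists_nbr h.properOn j
      exact hpj u hu.ne' hu hcu
    · obtain ⟨u, hu1, hu2, hu3⟩ := h.exists_nbr_left hG hjx
      exact hpj u hu1 hu2 hu3
    · obtain ⟨u, hu1, hu2, hu3⟩ := h.symm.exists_nbr_left hG hjy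
      exact hpj u hu1 hu2 hu3
    · obtain ⟨h1, h2, h3⟩ := h.recolor hjx hjy hp hpj
      have := Set.ncard_sdiff_singleton_lt_of_mem hp
      refine ih _ ?_ h1
      rw [h2, h3]
      omega
    · obtain ⟨h1, h2, h3⟩ := h.symm.recolor hjy hjx hp hpj
      have := Set.ncard_sdiff_singleton_lt_of_mem hp
      refine ih _ ?_ h1.symm
      rw [h2, h3]
      omega

/-! ### Large cliques in critical graphs -/

namespace IsP5Critical

variable [Fintype V] [DecidableEq V] {k : ℕ} {c : V → Fin k} {v : V}

/-- An uncoloured vertex lies in a `k`-clique of unique neighbours, and all its neighbours outside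
this clique have the same colour `i₀`, which does not occur in the clique. -/
theorem exists_clique (hG : G.IsP5Critical k) (hc : G.ProperOn {v}ᶜ c) :
    ∃ (Q : Finset V) (i₀ : Fin k), Q.card = k ∧ (∀ u ∈ Q, ∀ w ∈ Q, u ≠ w → G.Adj u w) ∧ v ∈ Q ∧
      (∀ u ∈ Q, u ≠ v → G.IsUniqueNbr c v u ∧ c u ≠ i₀) ∧
      ∀ u, u ∉ Q → G.Adj v u → c u = i₀ := by
  classical
  have hk := hG.eight_le
  let N : Finset V := Finset.univ.filter fun u => G.Adj v u
  let B : Finset (Fin k) := Finset.univ.filter fun j => ∃ u ∈ N, ∃ w ∈ N, u ≠ w ∧ c u = j ∧ c w = j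
  have h1 : (Finset.univ : Finset (Fin k)).card + B.card ≤ N.card := by
    refine card_add_card_repeated_le (c := c) (Finset.subset_univ _) (fun j _ => ?_) (fun j hj => ?_)
    · obtain ⟨u, hu, hcu⟩ := hG.exists_nbr hc j
      exact ⟨u, by simpa [N] using hu, hcu⟩
    · exact (Finset.mem_filter.1 hj).2
  have h2 := hG.card_nbrs_le v N (by simp [N])
  rw [Finset.card_univ, Fintype.card_fin] at h1
  have : NeZero k := ⟨by omega⟩
  obtain ⟨i₀, hi₀⟩ : ∃ i₀, B ⊆ {i₀} := by
    rcases B.eq_empty_or_nonempty with h | ⟨i, hi⟩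
    · exact ⟨0, by simp [h]⟩
    · exact ⟨i, fun j hj => by
        rw [Finset.mem_singleton]
        exact Finset.card_le_one.1 (by omega : B.card ≤ 1) j hj i hi⟩
  let S : Finset V := N.filter fun u => c u ≠ i₀
  have hS : ∀ u, u ∈ S ↔ G.Adj v u ∧ c u ≠ i₀ := by intro u; simp [S, N]
  have hU : ∀ u ∈ S, G.IsUniqueNbr c v u := by
    intro u hu
    obtain ⟨hu1, hu2⟩ := (hS u).1 hu
    refine ⟨hu1, fun w hw hcw => ?_⟩
    by_contra hwu
    have : c u ∈ B := Finset.mem_filter.2 ⟨Finset.mem_univ _, w, by simpa [N] using hw, u,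
      by simpa [N] using hu1, hwu, hcw, rfl⟩
    exact hu2 (by simpa using hi₀ this)
  have hvS : v ∉ S := fun h => ((hS v).1 h).1.ne rfl
  have hclique : ∀ u ∈ insert v S, ∀ w ∈ insert v S, u ≠ w → G.Adj u w := by
    intro u hu w hw huw
    rcases Finset.mem_insert.1 hu with rfl | hu <;> rcases Finset.mem_insert.1 hw with rfl | hw
    · exact (huw rfl).elim
    · exact (hU w hw).1
    · exact (hU u hu).1.symm
    · by_contra h
      exact hG.not_isBadPair ⟨hc, hU u hu, hU w hw, huw, h⟩
  have hSk : k ≤ S.card + 1 := by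
    have h3 : (Finset.univ.erase i₀).card ≤ (S.image c).card := by
      refine Finset.card_le_card fun j hj => ?_
      obtain ⟨u, hu, hcu⟩ := hG.exists_nbr hc j
      exact Finset.mem_image.2 ⟨u, (hS u).2 ⟨hu, hcu ▸ Finset.ne_of_mem_erase hj⟩, hcu⟩
    rw [Finset.card_erase_of_mem (Finset.mem_univ _), Finset.card_univ, Fintype.card_fin] at h3
    have := Finset.card_image_le (s := S) (f := c)
    omega
  refine ⟨insert v S, i₀, ?_, hclique, Finset.mem_insert_self _ _, ?_, ?_⟩
  · have := hG.card_clique_le _ hclique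
    rw [Finset.card_insert_of_notMem hvS] at this ⊢
    omega
  · intro u hu huv
    have hu' := Finset.mem_of_mem_insert_of_ne hu huv
    exact ⟨hU u hu', ((hS u).1 hu').2⟩
  · intro u hu hvu
    by_contra h
    exact hu (Finset.mem_insert_of_mem ((hS u).2 ⟨hvu, h⟩))

theorem card_outNbrs_le (hG : G.IsP5Critical k) {R P : Finset V} (hPR : P ⊆ R) {x : V}
    (hP : ∀ u ∈ P, G.Adj x u) : P.card + (outNbrs G R x).card ≤ k + 1 := by
  rw [← Finset.card_union_of_disjoint]
  · refine hG.card_nbrs_le x _ fun u hu => ?_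
    rcases Finset.mem_union.1 hu with hu | hu
    · exact hP u hu
    · exact (mem_outNbrs.1 hu).2
  · exact Finset.disjoint_left.2 fun u hu hu' => (mem_outNbrs.1 hu').1 (hPR hu)

/-- Let `K` be a clique on `k - 1` vertices, joined completely to a set `D` of two or three
independent vertices. If a colouring of the rest does not extend, then some colour occurs outside
around every vertex of `K`: otherwise `D` gets one common colour and Hall's theorem colours `K`. -/
theorem exists_common_color (hG : G.IsP5Critical k) {K D : Finset V} (hKk : K.card + 1 = k)
    (hK : ∀ u ∈ K, ∀ w ∈ K, u ≠ w → G.Adj u w) (hD : ∀ u ∈ D, ∀ w ∈ D, ¬ G.Adj u w)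
    (hKD : ∀ u ∈ K, ∀ w ∈ D, G.Adj u w) (hD2 : 2 ≤ D.card) (hD3 : D.card ≤ 3)
    (hc : G.ProperOn (↑(K ∪ D))ᶜ c) :
    ∃ e, ∀ x ∈ K, ∃ u, u ∉ K ∪ D ∧ G.Adj x u ∧ c u = e := by
  by_contra! hno
  have hk := hG.eight_le
  have hdisj : Disjoint K D := Finset.disjoint_left.2 fun u hu hu' => (hKD u hu u hu').ne rfl
  have hOD : ∀ y ∈ D, ((outNbrs G (K ∪ D) y).image c).card ≤ 2 := by
    intro y hy
    have := hG.card_outNbrs_le (R := K ∪ D) (P := K) Finset.subset_union_left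
      (x := y) fun u hu => (hKD u hu y hy).symm
    have h2 := Finset.card_image_le (s := outNbrs G (K ∪ D) y) (f := c)
    omega
  have hOK : ∀ x ∈ K, ((outNbrs G (K ∪ D) x).image c).card ≤ 1 := by
    intro x hx
    have h1 := hG.card_outNbrs_le (R := K ∪ D) (P := K.erase x ∪ D)
      (Finset.union_subset_union_left (Finset.erase_subset _ _)) (x := x) fun u hu => by
        rcases Finset.mem_union.1 hu with hu | hu
        · exact hK x hx u (Finset.mem_of_mem_erase hu) (Finset.ne_of_mem_erase hu).symm
        · exact hKD x hx u hu
    rw [Finset.card_union_of_disjoint (hdisj.mono_left (Finset.erase_subset _ _)),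
      Finset.card_erase_of_mem hx] at h1
    have h2 := Finset.card_image_le (s := outNbrs G (K ∪ D) x) (f := c)
    omega
  obtain ⟨d, hd⟩ : ∃ d, d ∉ D.biUnion fun y => (outNbrs G (K ∪ D) y).image c := by
    by_contra! h
    have h1 := Finset.card_biUnion_le_card_mul D _ _ hOD
    rw [Finset.eq_univ_iff_forall.2 h, Finset.card_univ, Fintype.card_fin] at h1
    omega
  have hd' : ∀ y ∈ D, ∀ u, u ∉ K ∪ D → G.Adj y u → c u ≠ d := fun y hy u hu hyu hcu =>
    hd (Finset.mem_biUnion.2 ⟨y, hy, Finset.mem_image.2 ⟨u, mem_outNbrs.2 ⟨hu, hyu⟩, hcu⟩⟩)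
  have hcard : (Finset.univ.erase d).card = k - 1 := by
    rw [Finset.card_erase_of_mem (Finset.mem_univ _), Finset.card_univ, Fintype.card_fin]
  obtain ⟨f, hf, hft⟩ := exists_injOn_of_lists (s := K) (n := k - 2)
    (t := fun x => Finset.univ.erase d \ (outNbrs G (K ∪ D) x).image c) (by omega) (by
      intro x hx
      have h1 := Finset.le_card_sdiff ((outNbrs G (K ∪ D) x).image c) (Finset.univ.erase d)
      have h2 := hOK x hx
      omega) (by
      have : Finset.univ.erase d ⊆
          K.biUnion fun x => Finset.univ.erase d \ (outNbrs G (K ∪ D) x).image c := by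
        intro e he
        obtain ⟨x, hx, hxe⟩ := hno e
        refine Finset.mem_biUnion.2 ⟨x, hx, Finset.mem_sdiff.2 ⟨he, fun h => ?_⟩⟩
        obtain ⟨u, hu, hcu⟩ := Finset.mem_image.1 h
        exact hxe u (mem_outNbrs.1 hu).1 (mem_outNbrs.1 hu).2 hcu
      have := Finset.card_le_card this
      omega)
  have hfd : ∀ x ∈ K, f x ≠ d := fun x hx =>
    Finset.ne_of_mem_erase (Finset.mem_sdiff.1 (hft x hx)).1
  have hfo : ∀ x ∈ K, ∀ u, u ∉ K ∪ D → G.Adj x u → f x ≠ c u := fun x hx u hu hxu h =>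
    (Finset.mem_sdiff.1 (hft x hx)).2 (Finset.mem_image.2 ⟨u, mem_outNbrs.2 ⟨hu, hxu⟩, h.symm⟩)
  refine hG.not_properOn (fun u => if u ∈ D then d else if u ∈ K then f u else c u) ?_
  intro u _ w _ huw
  have hout : ∀ u, u ∉ D → u ∉ K → u ∉ K ∪ D := fun u h1 h2 h3 =>
    (Finset.mem_union.1 h3).elim h2 h1
  by_cases u1 : u ∈ D <;> by_cases w1 : w ∈ D
  · exact (hD u u1 w w1 huw).elim
  · by_cases w2 : w ∈ K
    · simpa [u1, w1, w2] using (hfd w w2).symm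
    · simpa [u1, w1, w2] using (hd' u u1 w (hout w w1 w2) huw).symm
  · by_cases u2 : u ∈ K
    · simpa [u1, w1, u2] using hfd u u2
    · simpa [u1, w1, u2] using hd' w w1 u (hout u u1 u2) huw.symm
  · by_cases u2 : u ∈ K <;> by_cases w2 : w ∈ K
    · simpa [u1, w1, u2, w2] using fun h => huw.ne (hf u2 w2 h)
    · simpa [u1, w1, u2, w2] using hfo u u2 w (hout w w1 w2) huw
    · simpa [u1, w1, u2, w2] using (hfo w w2 u (hout u u1 u2) huw.symm).symm
    · simpa [u1, w1, u2, w2] using hc u (hout u u1 u2) w (hout w w1 w2) huw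

/-- Suppose that no vertex of `H` is complete to `K`, that `H` can be coloured so that all
neighbours of `K` in `H` have colour `γ`, and that in every such colouring every Kempe chain in `γ`
and another colour that starts at a neighbour of `K` contains a neighbour of each vertex of `K`.
This is impossible: a neighbour `z` of `K` has a colour `δ` occurring only once around it, at `w`
say. Since chains are short, `w` has at least four neighbours of colour `γ`, so `w` can be
recoloured, which breaks the chain of `z`. -/
theorem not_rigid (hG : G.IsP5Critical k) {H : Set V} {K : Finset V} (hK : 7 ≤ K.card)
    (hKH : ∀ x ∈ K, x ∉ H) {γ : Fin k} (h1 : ∀ z ∈ H, ∃ x ∈ K, ¬ G.Adj z x)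
    (hrigid : ∀ c : V → Fin k, G.ProperOn H c → (∀ x ∈ K, ∀ u ∈ H, G.Adj x u → c u = γ) →
      ∀ x ∈ K, ∀ z ∈ H, G.Adj x z → ∀ δ, δ ≠ γ → ∀ x' ∈ K,
        ∃ u ∈ H, G.Adj x' u ∧ G.KempeReach H c γ δ z u)
    (hc : G.ProperOn H c) (hγ : ∀ x ∈ K, ∀ u ∈ H, G.Adj x u → c u = γ)
    {x z : V} (hx : x ∈ K) (hz : z ∈ H) (hxz : G.Adj x z) : False := by
  classical
  have hk := hG.eight_le
  have hP := hG.noInducedP5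
  have common : ∀ c : V → Fin k, G.ProperOn H c → (∀ x ∈ K, ∀ u ∈ H, G.Adj x u → c u = γ) →
      ∀ x ∈ K, ∀ z ∈ H, G.Adj x z → ∀ δ, δ ≠ γ → ∀ x' ∈ K, ∀ u ∈ H, G.Adj x' u →
        G.KempeReach H c γ δ z u → u = z ∨ ∃ w ∈ H, c w = δ ∧ G.Adj z w ∧ G.Adj w u := by
    intro c hc hγ x hx z hz hxz δ hδ x' hx' u hu hxu hr
    have hcu := hγ x' hx' u hu hxu
    rcases hr.short hP hc (hγ x hx z hz hxz) hz with h | h | h | h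
    · exact Or.inl h
    · exact (hδ (h.1.symm.trans hcu)).elim
    · exact Or.inr h.2
    · exact (hδ (h.1.symm.trans hcu)).elim
  have nbr : ∀ c : V → Fin k, G.ProperOn H c → (∀ x ∈ K, ∀ u ∈ H, G.Adj x u → c u = γ) →
      ∀ x ∈ K, ∀ z ∈ H, G.Adj x z → ∀ δ, δ ≠ γ → ∃ u ∈ H, G.Adj z u ∧ c u = δ := by
    intro c hc hγ x hx z hz hxz δ hδ
    obtain ⟨x', hx', hzx'⟩ := h1 z hz
    obtain ⟨u, hu, hxu, hr⟩ := hrigid c hc hγ x hx z hz hxz δ hδ x' hx'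
    rcases common c hc hγ x hx z hz hxz δ hδ x' hx' u hu hxu hr with rfl | ⟨w, hw, h2, h3, -⟩
    · exact (hzx' hxu.symm).elim
    · exact ⟨w, hw, h3, h2⟩
  let N : V → Finset V := fun z => Finset.univ.filter fun u => u ∈ H ∧ G.Adj z u
  have hN : ∀ z u, u ∈ N z ↔ u ∈ H ∧ G.Adj z u := by intro z u; simp [N]
  have hdeg : ∀ z, (K.filter fun x => G.Adj z x).card + (N z).card ≤ k + 1 := by
    intro z
    rw [← Finset.card_union_of_disjoint]
    · refine hG.card_nbrs_le z _ fun u hu => ?_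
      rcases Finset.mem_union.1 hu with hu | hu
      · exact (Finset.mem_filter.1 hu).2
      · exact ((hN z u).1 hu).2
    · exact Finset.disjoint_left.2 fun u hu hu' =>
        hKH u (Finset.mem_filter.1 hu).1 ((hN z u).1 hu').1
  have hJ : (Finset.univ.erase γ).card = k - 1 := by
    rw [Finset.card_erase_of_mem (Finset.mem_univ _), Finset.card_univ, Fintype.card_fin]
  have hfew : ∀ x ∈ K, ∀ z ∈ H, G.Adj x z → (K.filter fun x => G.Adj z x).card ≤ 2 := by
    intro x hx z hz hxz
    have := card_add_card_repeated_le (N := N z) (c := c) (J := Finset.univ.erase γ) (B := ∅)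
      (Finset.empty_subset _) (fun δ hδ => by
        obtain ⟨u, hu, hzu, hcu⟩ := nbr c hc hγ x hx z hz hxz δ (Finset.ne_of_mem_erase hδ)
        exact ⟨u, (hN z u).2 ⟨hu, hzu⟩, hcu⟩) (by simp)
    have h2 := hdeg z
    rw [hJ] at this
    simp only [Finset.card_empty] at this
    omega
  obtain ⟨δ, hδ, hδu⟩ : ∃ δ, δ ≠ γ ∧ ∀ u ∈ N z, ∀ w ∈ N z, c u = δ → c w = δ → u = w := by
    by_contra! hno
    have := card_add_card_repeated_le (N := N z) (c := c) (J := Finset.univ.erase γ)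
      (B := Finset.univ.erase γ) subset_rfl (fun δ hδ => by
        obtain ⟨u, hu, w, hw, h2, h3, h4⟩ := hno δ (Finset.ne_of_mem_erase hδ)
        exact ⟨u, hu, h2⟩) (fun δ hδ => by
        obtain ⟨u, hu, w, hw, h2, h3, h4⟩ := hno δ (Finset.ne_of_mem_erase hδ)
        exact ⟨u, hu, w, hw, h4, h2, h3⟩)
    have h2 := hdeg z
    rw [hJ] at this
    omega
  obtain ⟨w, hw, hzw, hcw⟩ := nbr c hc hγ x hx z hz hxz δ hδ
  have hwu : ∀ u ∈ H, G.Adj z u → c u = δ → u = w := fun u hu hzu hcu =>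
    hδu u ((hN z u).2 ⟨hu, hzu⟩) w ((hN z w).2 ⟨hw, hzw⟩) hcu hcw
  -- The neighbours of `K` in the chain of `z` are all adjacent to `w`, and there are at least four.
  let W : Finset V := Finset.univ.filter fun u =>
    u ∈ H ∧ (∃ x ∈ K, G.Adj x u) ∧ G.KempeReach H c γ δ z u
  have hW : ∀ u, u ∈ W ↔ u ∈ H ∧ (∃ x ∈ K, G.Adj x u) ∧ G.KempeReach H c γ δ z u := by
    intro u; simp [W]
  have hW4 : 4 ≤ W.card := by
    have h2 : K ⊆ W.biUnion fun u => K.filter fun x => G.Adj u x := by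
      intro x' hx'
      obtain ⟨u, hu, hxu, hr⟩ := hrigid c hc hγ x hx z hz hxz δ hδ x' hx'
      exact Finset.mem_biUnion.2 ⟨u, (hW u).2 ⟨hu, ⟨x', hx', hxu⟩, hr⟩,
        Finset.mem_filter.2 ⟨hx', hxu.symm⟩⟩
    have h3 := Finset.card_le_card h2
    have h4 := Finset.card_biUnion_le_card_mul W (fun u => K.filter fun x => G.Adj u x) 2 (by
      intro u hu
      obtain ⟨hu, ⟨x', hx', hxu⟩, -⟩ := (hW u).1 hu
      exact hfew x' hx' u hu hxu)
    omega
  have hWw : ∀ u ∈ W, G.Adj w u := by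
    intro u hu
    obtain ⟨hu, ⟨x', hx', hxu⟩, hr⟩ := (hW u).1 hu
    rcases common c hc hγ x hx z hz hxz δ hδ x' hx' u hu hxu hr with rfl | ⟨w', hw', h2, h3, h4⟩
    · exact hzw.symm
    · exact hwu w' hw' h3 h2 ▸ h4
  obtain ⟨ε, hεγ, hεδ, hε⟩ : ∃ ε, ε ≠ γ ∧ ε ≠ δ ∧ ∀ u ∈ H, G.Adj w u → c u ≠ ε := by
    by_contra! hno
    let M : Finset V := (N w).filter fun u => c u ≠ γ
    have hM : ∀ u, u ∈ M ↔ (u ∈ H ∧ G.Adj w u) ∧ c u ≠ γ := by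
      intro u; simp only [M, Finset.mem_filter, hN]
    have h2 := card_add_card_repeated_le (N := M) (c := c) (J := (Finset.univ.erase γ).erase δ)
      (B := ∅) (Finset.empty_subset _) (fun ε hε => by
        simp only [Finset.mem_erase, Finset.mem_univ, and_true] at hε
        obtain ⟨u, hu, hwu, hcu⟩ := hno ε hε.2 hε.1
        exact ⟨u, (hM u).2 ⟨⟨hu, hwu⟩, hcu ▸ hε.2⟩, hcu⟩) (by simp)
    rw [Finset.card_erase_of_mem (Finset.mem_erase.2 ⟨hδ, Finset.mem_univ _⟩), hJ,
      Finset.card_empty] at h2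
    have h3 : Disjoint M W := Finset.disjoint_left.2 fun u hu hu' => by
      obtain ⟨huH, ⟨x', hx', hxu⟩, -⟩ := (hW u).1 hu'
      exact ((hM u).1 hu).2 (hγ x' hx' u huH hxu)
    have h4 := hG.card_nbrs_le w (M ∪ W) (fun u hu => by
      rcases Finset.mem_union.1 hu with hu | hu
      · exact ((hM u).1 hu).1.2
      · exact hWw u hu)
    rw [Finset.card_union_of_disjoint h3] at h4
    omega
  obtain ⟨u, hu, hzu, hcu⟩ := nbr (Function.update c w ε) (hc.update hε) (by
    intro x' hx' u hu hxu
    have h2 := hγ x' hx' u hu hxu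
    have h3 : u ≠ w := fun h => hδ (hcw ▸ h ▸ h2)
    simpa [h3] using h2) x hx z hz hxz δ hδ
  by_cases huw : u = w
  · subst huw; exact hεδ (by simpa using hcu)
  · exact huw (hwu u hu hzu (by simpa [huw] using hcu))

/-- No vertex outside a `k`-clique is adjacent to all but one of its vertices. -/
theorem not_adj_erase (hG : G.IsP5Critical k) {Q : Finset V} (hQk : Q.card = k)
    (hQ : ∀ u ∈ Q, ∀ w ∈ Q, u ≠ w → G.Adj u w) {q y : V} (hq : q ∈ Q) (hy : y ∉ Q)
    (hyQ : ∀ u ∈ Q, u ≠ q → G.Adj y u) : False := by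
  have hk := hG.eight_le
  set K : Finset V := Q.erase q with hKdef
  have hKmem : ∀ u, u ∈ K ↔ u ≠ q ∧ u ∈ Q := by intro u; simp [hKdef]
  have hKk : K.card + 1 = k := by rw [hKdef, Finset.card_erase_add_one hq, hQk]
  have hK : ∀ u ∈ K, ∀ w ∈ K, u ≠ w → G.Adj u w := fun u hu w hw =>
    hQ u ((hKmem u).1 hu).2 w ((hKmem w).1 hw).2
  have hKq : ∀ u ∈ K, G.Adj u q := fun u hu =>
    hQ u ((hKmem u).1 hu).2 q hq ((hKmem u).1 hu).1
  have hKy : ∀ u ∈ K, G.Adj u y := fun u hu => (hyQ u ((hKmem u).1 hu).2 ((hKmem u).1 hu).1).symm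
  have hqK : q ∉ K := fun h => ((hKmem q).1 h).1 rfl
  have hyK : y ∉ K := fun h => hy ((hKmem y).1 h).2
  have hqy : ¬ G.Adj q y := by
    intro h
    obtain ⟨x, hx, hyx⟩ := hG.exists_not_adj hQk hQ hy
    by_cases hxq : x = q
    · exact hyx (hxq ▸ h.symm)
    · exact hyx (hyQ x hx hxq)
  have hqy' : q ≠ y := fun h => hy (h ▸ hq)
  have hnoz : ∀ p, p ∉ K → (∀ u ∈ K, G.Adj u p) → ∀ z, z ∉ K → (∀ u ∈ K, G.Adj z u) →
      ¬ G.Adj z p := by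
    intro p hp hKp z hz hzK hzp
    obtain ⟨x, hx, hzx⟩ := hG.exists_not_adj (Q := insert p K) (z := z)
      (by rw [Finset.card_insert_of_notMem hp, hKk]) (by
        intro u hu w hw huw
        rcases Finset.mem_insert.1 hu with rfl | hu' <;> rcases Finset.mem_insert.1 hw with rfl | hw'
        · exact (huw rfl).elim
        · exact (hKp w hw').symm
        · exact hKp u hu'
        · exact hK u hu' w hw' huw)
      (by
        intro h
        rcases Finset.mem_insert.1 h with rfl | h
        · exact hzp.ne rfl
        · exact hz h)
    rcases Finset.mem_insert.1 hx with rfl | hx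
    · exact hzx hzp
    · exact hzx (hzK x hx)
  set D : Finset V := {q, y} with hDdef
  have hD2 : D.card = 2 := Finset.card_pair hqy'
  have hD : ∀ u ∈ D, ∀ w ∈ D, ¬ G.Adj u w := by
    intro u hu w hw
    simp only [hDdef, Finset.mem_insert, Finset.mem_singleton] at hu hw
    rcases hu with rfl | rfl <;> rcases hw with rfl | rfl
    · exact G.loopless.irrefl _
    · exact hqy
    · exact fun h => hqy h.symm
    · exact G.loopless.irrefl _
  have hKD : ∀ u ∈ K, ∀ w ∈ D, G.Adj u w := by
    intro u hu w hw
    simp only [hDdef, Finset.mem_insert, Finset.mem_singleton] at hw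
    rcases hw with rfl | rfl
    · exact hKq u hu
    · exact hKy u hu
  have hout : ∀ D' : Finset V, (∀ u ∈ K, ∀ w ∈ D', G.Adj u w) → ∀ x ∈ K,
      D'.card + (outNbrs G (K ∪ D') x).card ≤ 3 := by
    intro D' hKD' x hx
    have h1 := hG.card_outNbrs_le (R := K ∪ D') (P := K.erase x ∪ D')
      (Finset.union_subset_union_left (Finset.erase_subset _ _)) (x := x) fun u hu => by
        rcases Finset.mem_union.1 hu with hu | hu
        · exact hK x hx u (Finset.mem_of_mem_erase hu) (Finset.ne_of_mem_erase hu).symm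
        · exact hKD' x hx u hu
    have hdisj : Disjoint (K.erase x) D' := Finset.disjoint_left.2 fun u hu hu' =>
      (hKD' u (Finset.mem_of_mem_erase hu) u hu').ne rfl
    rw [Finset.card_union_of_disjoint hdisj, Finset.card_erase_of_mem hx] at h1
    omega
  have huniq : ∀ x ∈ K, ∀ u w, u ∉ K ∪ D → w ∉ K ∪ D → G.Adj x u → G.Adj x w → u = w := by
    intro x hx u w hu hw hxu hxw
    have := hout D hKD x hx
    exact Finset.card_le_one.1 (by omega : (outNbrs G (K ∪ D) x).card ≤ 1) u
      (mem_outNbrs.2 ⟨hu, hxu⟩) w (mem_outNbrs.2 ⟨hw, hxw⟩)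
  obtain ⟨x₀, hx₀⟩ : K.Nonempty := Finset.card_pos.1 (by omega)
  obtain ⟨c, hc⟩ := hG.exists_properOn_compl (R := K ∪ D) (Finset.mem_union_left _ hx₀)
  obtain ⟨γ, hγ⟩ := hG.exists_common_color hKk hK hD hKD hD2.ge (by omega) hc
  obtain ⟨z₀, hz₀, hxz₀, -⟩ := hγ x₀ hx₀
  refine hG.not_rigid (H := (↑(K ∪ D))ᶜ) (K := K) (γ := γ) (by omega)
    (fun x hx hxH => hxH (Finset.mem_union_left _ hx)) ?_ ?_ hc ?_ hx₀ hz₀ hxz₀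
  · -- If `z` were complete to `K`, then `{q, y, z}` would be independent, and no vertex of `K`
    -- would have further neighbours.
    intro z hz
    by_contra! hzK
    have hz' : z ∉ K ∪ D := hz
    have hzK' : z ∉ K := fun h => hz' (Finset.mem_union_left _ h)
    have hzD : z ∉ D := fun h => hz' (Finset.mem_union_right _ h)
    have hzD' : ∀ w ∈ D, ¬ G.Adj z w := by
      intro w hw
      simp only [hDdef, Finset.mem_insert, Finset.mem_singleton] at hw
      rcases hw with rfl | rfl
      · exact hnoz _ hqK hKq z hzK' hzK
      · exact hnoz _ hyK hKy z hzK' hzK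
    have hKD' : ∀ u ∈ K, ∀ w ∈ insert z D, G.Adj u w := by
      intro u hu w hw
      rcases Finset.mem_insert.1 hw with rfl | hw
      · exact (hzK u hu).symm
      · exact hKD u hu w hw
    have hD3 : (insert z D).card = 3 := by rw [Finset.card_insert_of_notMem hzD, hD2]
    obtain ⟨c', hc'⟩ := hG.exists_properOn_compl (R := K ∪ insert z D)
      (Finset.mem_union_left _ hx₀)
    obtain ⟨e, he⟩ := hG.exists_common_color hKk hK (D := insert z D) (by
      intro u hu w hw
      rcases Finset.mem_insert.1 hu with rfl | hu' <;> rcases Finset.mem_insert.1 hw with rfl | hw'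
      · exact G.loopless.irrefl _
      · exact hzD' w hw'
      · exact fun h => hzD' u hu' h.symm
      · exact hD u hu' w hw') hKD' (by omega) (by omega) hc'
    obtain ⟨u, hu, hxu, -⟩ := he x₀ hx₀
    have h1 := hout _ hKD' x₀ hx₀
    have h2 : 0 < (outNbrs G (K ∪ insert z D) x₀).card :=
      Finset.card_pos.2 ⟨u, mem_outNbrs.2 ⟨hu, hxu⟩⟩
    omega
  · -- Exchanging colours on the chain of `z` gives all outer neighbours of `K` the colour `δ`.
    intro c hc hγ x hx z hz hxz δ hδ x' hx'
    have hcz := hγ x hx z hz hxz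
    obtain ⟨e, he⟩ := hG.exists_common_color hKk hK hD hKD hD2.ge (by omega)
      (hc.kempeSwap (β := δ) hcz)
    obtain ⟨u, hu, hxu, hcu⟩ := he x hx
    obtain rfl := huniq x hx u z hu hz hxu hxz
    rw [kempeSwap_of_reach Relation.ReflTransGen.refl hcz] at hcu
    obtain ⟨u', hu', hxu', hcu'⟩ := he x' hx'
    refine ⟨u', hu', hxu', ?_⟩
    by_contra hr
    rw [kempeSwap_of_not_reach hr, hγ x' hx' u' hu' hxu'] at hcu'
    exact hδ (hcu.trans hcu'.symm)
  · intro x hx u hu hxu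
    obtain ⟨w, hw, hxw, hcw⟩ := hγ x hx
    rw [huniq x hx u w hu hw hxu hxw, hcw]

theorem card_outNbrs_clique_le (hG : G.IsP5Critical k) {Q : Finset V} (hQk : Q.card = k)
    (hQ : ∀ u ∈ Q, ∀ w ∈ Q, u ≠ w → G.Adj u w) {x : V} (hx : x ∈ Q) :
    (outNbrs G Q x).card ≤ 2 := by
  have := hG.card_outNbrs_le (Finset.erase_subset x Q) (x := x) fun u hu =>
    hQ x hx u (Finset.mem_of_mem_erase hu) (Finset.ne_of_mem_erase hu).symm
  rw [Finset.card_erase_of_mem hx] at this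
  omega

/-- Let `Q` be a `k`-clique and colour the rest so that every vertex of `Q` sees at most one outer
colour besides `i₀`. If some vertex of `Q` sees no outer colour besides `i₀`, then none does: for a
vertex `x₀` seeing another colour, Hall's theorem colours `Q - x₀` without `i₀`. Then `i₀` is either
free at `x₀`, or it occurs there at a unique neighbour, which must be adjacent to almost all
of `Q`. -/
theorem outer_color_eq (hG : G.IsP5Critical k) {Q : Finset V} (hQk : Q.card = k)
    (hQ : ∀ u ∈ Q, ∀ w ∈ Q, u ≠ w → G.Adj u w) (hc : G.ProperOn (↑Q)ᶜ c) {i₀ : Fin k}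
    (h2 : ∀ x ∈ Q, (insert i₀ ((outNbrs G Q x).image c)).card ≤ 2) {x₁ : V} (hx₁ : x₁ ∈ Q)
    (h1 : ∀ u, u ∉ Q → G.Adj x₁ u → c u = i₀) :
    ∀ x ∈ Q, ∀ u, u ∉ Q → G.Adj x u → c u = i₀ := by
  intro x₀ hx₀ u₀ hu₀ hxu₀
  by_contra hcu₀
  have hk := hG.eight_le
  have hx₁' : x₁ ∈ Q.erase x₀ := by
    refine Finset.mem_erase.2 ⟨?_, hx₁⟩
    rintro rfl
    exact hcu₀ (h1 u₀ hu₀ hxu₀)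
  have hcardQ : (Q.erase x₀).card = k - 1 := by rw [Finset.card_erase_of_mem hx₀, hQk]
  obtain ⟨f, hf, hft⟩ := exists_injOn_of_lists (s := Q.erase x₀) (n := k - 2)
    (t := fun x => Finset.univ \ insert i₀ ((outNbrs G Q x).image c)) (by omega) (by
      intro x hx
      have h3 := Finset.le_card_sdiff (insert i₀ ((outNbrs G Q x).image c)) Finset.univ
      have h4 := h2 x (Finset.mem_of_mem_erase hx)
      rw [Finset.card_univ, Fintype.card_fin] at h3
      omega) (by
      have h3 : Finset.univ.erase i₀ ⊆
          (Q.erase x₀).biUnion fun x => Finset.univ \ insert i₀ ((outNbrs G Q x).image c) := by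
        intro e he
        refine Finset.mem_biUnion.2 ⟨x₁, hx₁', Finset.mem_sdiff.2 ⟨Finset.mem_univ _, fun h => ?_⟩⟩
        rcases Finset.mem_insert.1 h with h | h
        · exact Finset.ne_of_mem_erase he h
        · obtain ⟨u, hu, hcu⟩ := Finset.mem_image.1 h
          obtain ⟨hu1, hu2⟩ := mem_outNbrs.1 hu
          exact Finset.ne_of_mem_erase he (hcu.symm.trans (h1 u hu1 hu2))
      have h4 := Finset.card_le_card h3
      rw [Finset.card_erase_of_mem (Finset.mem_univ _), Finset.card_univ, Fintype.card_fin] at h4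
      omega)
  have hfi : ∀ x ∈ Q.erase x₀, f x ≠ i₀ := fun x hx h =>
    (Finset.mem_sdiff.1 (hft x hx)).2 (h ▸ Finset.mem_insert_self _ _)
  have hfo : ∀ x ∈ Q.erase x₀, ∀ u, u ∉ Q → G.Adj x u → f x ≠ c u := fun x hx u hu hxu h =>
    (Finset.mem_sdiff.1 (hft x hx)).2 (Finset.mem_insert_of_mem
      (Finset.mem_image.2 ⟨u, mem_outNbrs.2 ⟨hu, hxu⟩, h.symm⟩))
  let c' : V → Fin k := fun u => if u ∈ Q then f u else c u
  have hcQ : ∀ u ∈ Q, c' u = f u := fun u hu => if_pos hu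
  have hcO : ∀ u, u ∉ Q → c' u = c u := fun u hu => if_neg hu
  have hc' : G.ProperOn {x₀}ᶜ c' := by
    intro u hu w hw huw
    have hu' : u ≠ x₀ := hu
    have hw' : w ≠ x₀ := hw
    by_cases u1 : u ∈ Q <;> by_cases w1 : w ∈ Q
    · rw [hcQ u u1, hcQ w w1]
      exact fun h => huw.ne (hf (Finset.mem_erase.2 ⟨hu', u1⟩) (Finset.mem_erase.2 ⟨hw', w1⟩) h)
    · rw [hcQ u u1, hcO w w1]
      exact hfo u (Finset.mem_erase.2 ⟨hu', u1⟩) w w1 huw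
    · rw [hcO u u1, hcQ w w1]
      exact (hfo w (Finset.mem_erase.2 ⟨hw', w1⟩) u u1 huw.symm).symm
    · rw [hcO u u1, hcO w w1]
      exact hc u u1 w w1 huw
  obtain ⟨y₀, hxy₀, hcy₀⟩ := hG.exists_nbr hc' i₀
  have hy₀ : y₀ ∉ Q := fun h => hfi y₀ (Finset.mem_erase.2 ⟨hxy₀.ne', h⟩) (hcQ y₀ h ▸ hcy₀)
  have hcy₀' : c y₀ = i₀ := hcO y₀ hy₀ ▸ hcy₀
  have hne : y₀ ≠ u₀ := fun h => hcu₀ (h ▸ hcy₀')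
  have hout : ∀ u, u ∉ Q → G.Adj x₀ u → u = y₀ ∨ u = u₀ := by
    intro u hu hxu
    by_contra! h
    have h3 : ({u, y₀, u₀} : Finset V) ⊆ outNbrs G Q x₀ := by
      intro w hw
      simp only [Finset.mem_insert, Finset.mem_singleton] at hw
      rcases hw with rfl | rfl | rfl
      · exact mem_outNbrs.2 ⟨hu, hxu⟩
      · exact mem_outNbrs.2 ⟨hy₀, hxy₀⟩
      · exact mem_outNbrs.2 ⟨hu₀, hxu₀⟩
    have h4 := Finset.card_le_card h3
    have h5 := hG.card_outNbrs_clique_le hQk hQ hx₀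
    rw [Finset.card_eq_three.2 ⟨u, y₀, u₀, h.1, h.2, hne, rfl⟩] at h4
    omega
  have hUy : G.IsUniqueNbr c' x₀ y₀ := by
    refine ⟨hxy₀, fun w hw hcw => ?_⟩
    rw [hcy₀] at hcw
    by_cases hwQ : w ∈ Q
    · exact (hfi w (Finset.mem_erase.2 ⟨hw.ne', hwQ⟩) (hcQ w hwQ ▸ hcw)).elim
    · rcases hout w hwQ hw with h | h
      · exact h
      · rw [hcO w hwQ, h] at hcw; exact (hcu₀ hcw).elim
  have hadj : ∀ x ∈ Q.erase x₀, f x ≠ c u₀ → G.Adj y₀ x := by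
    intro x hx hfx
    have hxQ := Finset.mem_of_mem_erase hx
    have hxx := Finset.ne_of_mem_erase hx
    have hUx : G.IsUniqueNbr c' x₀ x := by
      refine ⟨hQ x₀ hx₀ x hxQ hxx.symm, fun w hw hcw => ?_⟩
      rw [hcQ x hxQ] at hcw
      by_cases hwQ : w ∈ Q
      · rw [hcQ w hwQ] at hcw
        exact hf (Finset.mem_erase.2 ⟨hw.ne', hwQ⟩) hx hcw
      · rw [hcO w hwQ] at hcw
        rcases hout w hwQ hw with h | h
        · rw [h, hcy₀'] at hcw; exact (hfi x hx hcw.symm).elim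
        · rw [h] at hcw; exact (hfx hcw.symm).elim
    by_contra h
    exact hG.not_isBadPair ⟨hc', hUy, hUx, fun h' => hy₀ (h' ▸ hxQ), h⟩
  -- The vertex of `Q` to be left out is the one coloured like `u₀`; if there is none, any will do.
  obtain ⟨q, hq, hqf⟩ : ∃ q ∈ Q.erase x₀, ∀ x ∈ Q.erase x₀, x ≠ q → f x ≠ c u₀ := by
    by_cases h : ∃ q ∈ Q.erase x₀, f q = c u₀
    · obtain ⟨q, hq, hfq⟩ := h
      exact ⟨q, hq, fun x hx hxq hfx => hxq (hf hx hq (hfx.trans hfq.symm))⟩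
    · push Not at h
      exact ⟨x₁, hx₁', fun x hx _ => h x hx⟩
  refine hG.not_adj_erase hQk hQ (Finset.mem_of_mem_erase hq) hy₀ fun u hu huq => ?_
  by_cases hux : u = x₀
  · exact hux ▸ hxy₀.symm
  · exact hadj u (Finset.mem_erase.2 ⟨hux, hu⟩) (hqf u (Finset.mem_erase.2 ⟨hux, hu⟩) huq)

theorem false_of_isP5Critical (hG : G.IsP5Critical k) : False := by
  have hk := hG.eight_le
  rcases isEmpty_or_nonempty V with hV | ⟨⟨v⟩⟩
  · exact hG.not_properOn (fun u => (hV.false u).elim) fun u => (hV.false u).elim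
  obtain ⟨c, hc⟩ := hG.exists_properOn v
  obtain ⟨Q, i₀, hQk, hQ, hvQ, hQc, hQo⟩ := hG.exists_clique hc
  have hcQ : G.ProperOn (↑Q)ᶜ c := hc.mono fun u hu huv => hu (huv ▸ hvQ)
  -- Moving the uncoloured vertex through `Q` shows that all of `Q` sees `i₀` outside.
  have hsee : ∀ x ∈ Q, ∃ u, u ∉ Q ∧ G.Adj x u ∧ c u = i₀ := by
    intro x hx
    by_cases hxv : x = v
    · subst hxv
      obtain ⟨u, hu, hcu⟩ := hG.exists_nbr hc i₀
      exact ⟨u, fun h => (hQc u h hu.ne').2 hcu, hu, hcu⟩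
    · obtain ⟨u, hu, hcu⟩ := hG.exists_nbr ((hQc x hx hxv).1.shift hc) i₀
      have huv : u ≠ v := by
        rintro rfl
        exact (hQc x hx hxv).2 (by simpa using hcu)
      have hcu' : c u = i₀ := by simpa [huv] using hcu
      exact ⟨u, fun h => (hQc u h huv).2 hcu', hu, hcu'⟩
  have hmono : ∀ x ∈ Q, ∀ u ∈ ((↑Q)ᶜ : Set V), G.Adj x u → c u = i₀ :=
    hG.outer_color_eq hQk hQ hcQ (by
      intro x hx
      obtain ⟨u, hu, hxu, hcu⟩ := hsee x hx
      rw [Finset.insert_eq_of_mem (Finset.mem_image.2 ⟨u, mem_outNbrs.2 ⟨hu, hxu⟩, hcu⟩)]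
      exact Finset.card_image_le.trans (hG.card_outNbrs_clique_le hQk hQ hx)) hvQ hQo
  obtain ⟨z, hz, hvz, -⟩ := hsee v hvQ
  refine hG.not_rigid (H := (↑Q)ᶜ) (K := Q) (γ := i₀) (by omega) (fun x hx hxH => hxH hx)
    (fun z hz => hG.exists_not_adj hQk hQ hz) ?_ hcQ hmono hvQ hz hvz
  intro c hc hγ x hx z hz hxz δ hδ x' hx'
  by_contra! hno
  have hcz := hγ x hx z hz hxz
  have hcz' := hG.outer_color_eq hQk hQ (hc.kempeSwap (β := δ) hcz) (i₀ := i₀) (by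
    intro y hy
    refine (Finset.card_le_card (t := {i₀, δ}) ?_).trans Finset.card_le_two
    refine Finset.insert_subset (by simp) fun e he => ?_
    obtain ⟨u, hu, rfl⟩ := Finset.mem_image.1 he
    obtain ⟨hu1, hu2⟩ := mem_outNbrs.1 hu
    have hcu := hγ y hy u hu1 hu2
    by_cases hr : G.KempeReach (↑Q)ᶜ c i₀ δ z u
    · rw [kempeSwap_of_reach hr hcu]; simp
    · rw [kempeSwap_of_not_reach hr, hcu]; simp) hx' (by
    intro u hu hxu
    rw [kempeSwap_of_not_reach (hno u hu hxu), hγ x' hx' u hu hxu]) x hx z hz hxz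
  rw [kempeSwap_of_reach Relation.ReflTransGen.refl hcz] at hcz'
  exact hδ hcz'

end IsP5Critical

/-! ### The colouring theorem -/

/-- A `P₅`-free graph with maximum degree at most `k + 1` and clique number at most `k`, where
`k ≥ 8`, is `k`-colourable: a minimal set of vertices inducing a graph that is not would induce a
critical graph. -/
theorem NoInducedP5.colorable [Fintype V] {k : ℕ} (hk : 8 ≤ k) (hP : G.NoInducedP5)
    (hdeg : ∀ (v : V) (s : Finset V), (∀ u ∈ s, G.Adj v u) → s.card ≤ k + 1)
    (hcl : ∀ s : Finset V, (∀ u ∈ s, ∀ w ∈ s, u ≠ w → G.Adj u w) → s.card ≤ k) :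
    G.Colorable k := by
  classical
  by_contra hcol
  have huniv : ∀ c : V → Fin k, ¬ G.ProperOn ↑(Finset.univ : Finset V) c := fun c hc =>
    hcol ⟨Coloring.mk c fun {u w} huw => hc u (by simp) w (by simp) huw⟩
  obtain ⟨X, -, hX⟩ := exists_minimal_le_of_wellFoundedLT
    (fun X : Finset V => ∀ c : V → Fin k, ¬ G.ProperOn ↑X c) _ huniv
  refine IsP5Critical.false_of_isP5Critical (G := G.induce (↑X : Set V)) (k := k)
    ⟨hk, fun p q r s t => hP p q r s t, ?_, ?_, ?_, ?_⟩
  · intro v s hs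
    rw [← Finset.card_map (Function.Embedding.subtype _)]
    refine hdeg v _ fun u hu => ?_
    obtain ⟨u, hu', rfl⟩ := Finset.mem_map.1 hu
    exact hs u hu'
  · intro s hs
    rw [← Finset.card_map (Function.Embedding.subtype _)]
    refine hcl _ fun u hu w hw huw => ?_
    obtain ⟨u, hu', rfl⟩ := Finset.mem_map.1 hu
    obtain ⟨w, hw', rfl⟩ := Finset.mem_map.1 hw
    exact hs u hu' w hw' fun h => huw (by rw [h])
  · intro v
    have hv : (v : V) ∈ X := v.2
    have hlt := hX.not_prop_of_lt (Finset.erase_ssubset hv)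
    push Not at hlt
    obtain ⟨c, hc⟩ := hlt
    refine ⟨fun u => c u, fun u hu w hw huw => hc u ?_ w ?_ huw⟩
    · exact Finset.mem_coe.2 (Finset.mem_erase.2 ⟨fun h => hu (Subtype.ext h), u.2⟩)
    · exact Finset.mem_coe.2 (Finset.mem_erase.2 ⟨fun h => hw (Subtype.ext h), w.2⟩)
  · intro c hc
    refine hX.prop (fun u => if h : u ∈ X then c ⟨u, h⟩ else ⟨0, by omega⟩) ?_
    intro u hu w hw huw
    have hu' : u ∈ X := hu
    have hw' : w ∈ X := hw
    simpa [hu', hw'] using hc ⟨u, hu⟩ trivial ⟨w, hw⟩ trivial huw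

end SimpleGraph

theorem mainTheorem2 {V : Type*} [Fintype V] (G : SimpleGraph V) [DecidableRel G.Adj]
    (hP5 : ¬ (SimpleGraph.pathGraph 5).IsIndContained G)
    (hΔ : 9 ≤ G.maxDegree) :
    G.chromaticNumber ≤ ((max (G.maxDegree - 1) G.cliqueNum : ℕ) : ℕ∞) := by
  refine SimpleGraph.Colorable.chromaticNumber_le ?_
  refine (SimpleGraph.noInducedP5_of_not_isIndContained hP5).colorable (by omega) ?_ ?_
  · intro v s hs
    have h1 : s.card ≤ G.degree v := Finset.card_le_card fun u hu => by simpa using hs u hu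
    have h2 := G.degree_le_maxDegree v
    omega
  · intro s hs
    have : G.IsClique s := fun u hu w hw huw => hs u hu w hw huw
    exact this.card_le_cliqueNum.trans (le_max_right _ _)
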